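/- Let $M_n$ be the algebra of complex $n\times n$ matrices, $n\ge 1$, and let $A,B\in M_n$ be Hermitian with eigenvalues $a_1,\dots,a_n$ and $b_1,\dots,b_n$ respectively (listed with multiplicity, in any order). Put $\mathbf a=(a_1,\dots,a_n)$ and $\mathbf b=(b_1,\dots,b_n)$, regarded as row vectors. A linear map $\Phi:M_n\to M_n$ is completely positive if for every $k\ge 1$ the map $M_k(M_n)\to M_k(M_n)$, $(X_{ij})\mapsto(\Phi(X_{ij}))$, preserves positive semidefiniteness; it is unital if $\Phi(I)=I$, and trace preserving if $\operatorname{tr}\Phi(X)=\operatorname{tr}X$ for all $X\in M_n$. A completely positive map $\Phi$ is mixed unitary if there are unitary matrices $U_1,\dots,U_r\in M_n$ and positive numbers $t_1,\dots,t_r$ with sum $1$ such that $\Phi(X)=\sum_{j=1}^r t_jU_j^*XU_j$ for all $X\in M_n$. We write $\mathbf b\prec\mathbf a$ if for every $1\le k<n$ the sum of the $k$ largest entries of $\mathbf b$ is at most the sum of the $k$ largest entries of $\mathbf a$, and $\sum_{i=1}^n a_i=\sum_{i=1}^n b_i$. The following conditions are equivalent. * (a) There is a unital trace preserving completely positive map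 $\Phi:M_n\to M_n$ with $\Phi(A)=B$. * (a1) There is a mixed unitary completely positive map $\Phi:M_n\to M_n$ with $\Phi(A)=B$. * (a2) There are unitary matrices $U_1,\dots,U_n\in M_n$ with $B=\frac1n\sum_{j=1}^nU_j^*AU_j$. * (a3) For each $t\in\mathbb R$ there is a trace preserving completely positive map $\Phi_t:M_n\to M_n$ with $\Phi_t(A-tI)=B-tI$. * (b) There is a doubly stochastic matrix $D$ with $\mathbf b=\mathbf aD$. * (b1) There is a unitary matrix $W\in M_n$ such that $W\operatorname{diag}(a_1,\dots,a_n)W^*$ has diagonal entries $b_1,\dots,b_n$, in this order. * (c) $\mathbf b\prec\mathbf a$. Moreover, there are unitary matrices $U,V\in M_n$ with $U^*AU=\operatorname{diag}(a_1,\dots,a_n)$ and $VBV^*=\operatorname{diag}(b_1,\dots,b_n)$. If $D$ is a doubly stochastic matrix with $\mathbf b=\mathbf aD$, and $D=\sum_{\ell=1}^rt_\ell P_\ell$ with positive numbers $t_1,\dots,t_r$ summing to $1$ and permutation matrices $P_1,\dots,P_r$, then for all such $U$ and $V$ $$B=\sum_{\ell=1}^r t_\ell\,V^*P_\ell^{t}\,U^*AU\,P_\ell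 V .$$ -/

import Mathlib

open scoped Matrix

/-- `a` lists the eigenvalues of `A`, counted with algebraic multiplicity, in some order. -/
def IsEigenvalueVector {n : ℕ} (A : Matrix (Fin n) (Fin n) ℂ) (a : Fin n → ℝ) : Prop :=
  A.charpoly.roots = Finset.univ.val.map (fun i => (a i : ℂ))

open scoped MatrixOrder Matrix.Norms.L2Operator CStarAlgebra in
/-- Completely positive linear maps from `M_n` to `M_m` (complex matrices with their usual
C⋆-algebra structure and the Loewner order). -/
abbrev MatrixCPMap (n m : ℕ) : Type :=
  Matrix (Fin n) (Fin n) ℂ →CP Matrix (Fin m) (Fin m) ℂ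

namespace MatrixCPMap

/-- `Φ(I_n) = I_m`. -/
def IsUnital {n m : ℕ} (Φ : MatrixCPMap n m) : Prop :=
  Φ 1 = 1

/-- `tr Φ(X) = tr X` for all `X`. -/
def IsTracePreserving {n m : ℕ} (Φ : MatrixCPMap n m) : Prop :=
  ∀ X : Matrix (Fin n) (Fin n) ℂ, (Φ X).trace = X.trace

/-- `Φ(X) = ∑ j, t j • (U j)ᴴ X (U j)` with unitaries `U j` and positive weights `t j` summing
to `1`. -/
def IsMixedUnitary {n : ℕ} (Φ : MatrixCPMap n n) : Prop :=
  ∃ (r : ℕ) (t : Fin r → ℝ) (U : Fin r → Matrix (Fin n) (Fin n) ℂ),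
    (∀ j, 0 < t j) ∧ ∑ j, t j = 1 ∧ (∀ j, U j ∈ Matrix.unitaryGroup (Fin n) ℂ) ∧
      ∀ X : Matrix (Fin n) (Fin n) ℂ, Φ X = ∑ j, (t j : ℂ) • ((U j)ᴴ * X * U j)

end MatrixCPMap

/-- The entries of `x`, rearranged in decreasing order. -/
noncomputable def decreasingRearrangement {n : ℕ} (x : Fin n → ℝ) : Fin n → ℝ :=
  fun i => x (Tuple.sort (fun j => -x j) i)

theorem antitone_decreasingRearrangement {n : ℕ} (x : Fin n → ℝ) :
    Antitone (decreasingRearrangement x) := fun _ _ hij =>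
  neg_le_neg_iff.mp (Tuple.monotone_sort (fun j => -x j) hij)

/-- The sum of the `k` largest entries of `x` (for `k ≤ n`). -/
noncomputable def sumLargest {n : ℕ} (k : ℕ) (x : Fin n → ℝ) : ℝ :=
  ∑ i : Fin n with i.val < k, decreasingRearrangement x i

/-- `b` is majorized by `a`, written `b ≺ a`. -/
def IsMajorizedBy {n : ℕ} (b a : Fin n → ℝ) : Prop :=
  (∀ k : ℕ, 1 ≤ k → k < n → sumLargest k b ≤ sumLargest k a) ∧ ∑ i, a i = ∑ i, b i

/-! ### Rearrangements and truncated sums -/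

/-! Everything passes through truncated sums: `b ≺ a` means equal totals together with `∑ (b i - t)⁺
≤ ∑ (a i - t)⁺` for every real `t` (`isMajorizedBy_iff_sum_max`).

Maps to majorization (`sum_max_le_of_isTracePreserving`): write `A - tI = P - N` with positive and
negative parts. In an eigenbasis of `B`, the positive matrices `Φ P` and `Φ N` have diagonals
differing by `b i - t`, so the diagonal of `Φ P` dominates `(b i - t)⁺`. Its trace is `tr P = ∑ (a i
- t)⁺`.

Majorization to a prescribed diagonal (`hasDiagonalOn_of_sum_max_le`, the hard half of Schur–Horn):
a plane rotation puts the largest `b p` on the diagonal and merges two entries of `a` into one.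
`sum_max_erase_le` shows that domination survives on the remaining coordinates, so induction
applies.

Prescribed diagonal to averages: the diagonal part of a matrix is the mean of its conjugates by `n`
diagonal unitaries built from roots of unity (`exists_average_eq_diagonal_diag`). Squared moduli of
the entries of `W` give a doubly stochastic matrix, and Birkhoff's theorem turns such a matrix into
a mixture of permutation conjugations. -/

theorem sum_comp_decreasingRearrangement {n : ℕ} (x : Fin n → ℝ) (f : ℝ → ℝ) :
    ∑ i, f (decreasingRearrangement x i) = ∑ i, f (x i) :=
  Equiv.sum_comp (Tuple.sort fun j => -x j) fun i => f (x i)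

theorem card_filter_val_lt {n k : ℕ} (hk : k ≤ n) :
    (Finset.univ.filter fun i : Fin n => i.val < k).card = k := by
  rw [Fin.card_filter_val_lt]
  exact min_eq_right hk

theorem sumLargest_sub_eq {n k : ℕ} (hk : k ≤ n) (x : Fin n → ℝ) (t : ℝ) :
    sumLargest k x - k * t =
      ∑ i : Fin n with i.val < k, (decreasingRearrangement x i - t) := by
  rw [Finset.sum_sub_distrib, Finset.sum_const, card_filter_val_lt hk, nsmul_eq_mul, sumLargest]

/-- This and the next two results say that `∑ (x i - t)⁺` is the maximum over `k` of `sumLargest k x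
- k * t`, attained when `t` separates the `k` largest entries from the rest. -/
theorem sumLargest_sub_le {n k : ℕ} (hk : k ≤ n) (x : Fin n → ℝ) (t : ℝ) :
    sumLargest k x - k * t ≤ ∑ i, max (x i - t) 0 := by
  rw [sumLargest_sub_eq hk, ← sum_comp_decreasingRearrangement x fun y => max (y - t) 0]
  calc _ ≤ ∑ i : Fin n with i.val < k, max (decreasingRearrangement x i - t) 0 :=
        Finset.sum_le_sum fun i _ => le_max_left _ _
    _ ≤ _ := Finset.sum_le_sum_of_subset_of_nonneg (Finset.filter_subset _ _)
        fun i _ _ => le_max_right _ _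

theorem sumLargest_sub_eq_of_threshold {n k : ℕ} (hk : k ≤ n) (x : Fin n → ℝ) (t : ℝ)
    (hlt : ∀ i : Fin n, i.val < k → t ≤ decreasingRearrangement x i)
    (hge : ∀ i : Fin n, k ≤ i.val → decreasingRearrangement x i ≤ t) :
    sumLargest k x - k * t = ∑ i, max (x i - t) 0 := by
  rw [sumLargest_sub_eq hk, ← sum_comp_decreasingRearrangement x fun y => max (y - t) 0,
    Finset.sum_filter]
  refine Finset.sum_congr rfl fun i _ => ?_
  split_ifs with h
  · exact (max_eq_left (sub_nonneg.mpr (hlt i h))).symm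
  · exact (max_eq_right (sub_nonpos.mpr (hge i (not_lt.mp h)))).symm

theorem exists_sumLargest_sub_eq {n : ℕ} (x : Fin n → ℝ) (t : ℝ) :
    ∃ k ≤ n, sumLargest k x - k * t = ∑ i, max (x i - t) 0 := by
  have hcard : ∀ i : Fin n,
      i.val < (Finset.univ.filter fun i => t < decreasingRearrangement x i).card ↔
      t < decreasingRearrangement x i := fun i =>
    Tuple.lt_card_gt_iff_apply_gt_of_antitone (antitone_decreasingRearrangement x)
  refine ⟨(Finset.univ.filter fun i => t < decreasingRearrangement x i).card,
    (Finset.card_le_univ _).trans_eq (Fintype.card_fin n), ?_⟩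
  refine sumLargest_sub_eq_of_threshold
    ((Finset.card_le_univ _).trans_eq (Fintype.card_fin n)) x t (fun i hi => ?_) fun i hi => ?_
  · exact ((hcard i).mp hi).le
  · exact not_lt.mp fun h => absurd ((hcard i).mpr h) (not_lt.mpr hi)

theorem sumLargest_zero {n : ℕ} (x : Fin n → ℝ) : sumLargest 0 x = 0 := by
  simp [sumLargest]

theorem sumLargest_self {n : ℕ} (x : Fin n → ℝ) : sumLargest n x = ∑ i, x i := by
  simpa [sumLargest] using sum_comp_decreasingRearrangement x id

/-- Majorization in terms of truncated sums. -/
theorem isMajorizedBy_iff_sum_max {n : ℕ} (b a : Fin n → ℝ) :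
    IsMajorizedBy b a ↔
      (∀ t : ℝ, ∑ i, max (b i - t) 0 ≤ ∑ i, max (a i - t) 0) ∧ ∑ i, a i = ∑ i, b i := by
  refine and_congr_left fun hsum => ⟨fun h t => ?_, fun h k hk hkn => ?_⟩
  · obtain ⟨k, hkn, hk⟩ := exists_sumLargest_sub_eq b t
    rw [← hk]
    refine le_trans ?_ (sumLargest_sub_le hkn a t)
    refine sub_le_sub_right ?_ _
    -- The extreme values `k = 0` and `k = n` are not covered by the majorization inequalities;
    -- there both sides agree.
    rcases k.eq_zero_or_pos with rfl | h0
    · rw [sumLargest_zero, sumLargest_zero]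
    rcases hkn.eq_or_lt with rfl | h1
    · rw [sumLargest_self, sumLargest_self, hsum]
    · exact h k h0 h1
  · have hlt : k - 1 < n := by omega
    -- The `k`-th largest entry of `a` (index `k - 1`) is a threshold for `a`, so the bound is an
    -- equality for `a`.
    set t := decreasingRearrangement a ⟨k - 1, hlt⟩
    have h1 := sumLargest_sub_eq_of_threshold hkn.le a t
      (fun i hi => antitone_decreasingRearrangement a (Fin.mk_le_mk.mpr (by omega)))
      (fun i hi => antitone_decreasingRearrangement a (Fin.mk_le_mk.mpr (by omega)))
    have h2 := sumLargest_sub_le hkn.le b t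
    linarith [h t]

/-! ### Completely positive maps of the form `X ↦ ∑ j, t j • (U j)ᴴ X (U j)` -/

-- Conjugating every block by `U` is conjugating the whole block matrix by the block diagonal matrix
-- with blocks `U`.
open scoped MatrixOrder Matrix.Norms.L2Operator CStarAlgebra in
theorem CStarMatrix.map_conjugate_nonneg {n k : ℕ} (U : Matrix (Fin n) (Fin n) ℂ)
    (M : CStarMatrix (Fin k) (Fin k) (Matrix (Fin n) (Fin n) ℂ)) (hM : 0 ≤ M) :
    0 ≤ M.map (fun X => Uᴴ * X * U) := by
  let D : CStarMatrix (Fin k) (Fin k) (Matrix (Fin n) (Fin n) ℂ) :=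
    CStarMatrix.ofMatrix (Matrix.diagonal fun _ => U)
  have h : M.map (fun X => Uᴴ * X * U) = star D * M * D := by
    have hD : star D = CStarMatrix.ofMatrix (Matrix.diagonal fun _ => Uᴴ) :=
      Matrix.diagonal_conjTranspose _
    have hmul : star D * M * D = CStarMatrix.ofMatrix
        ((Matrix.diagonal fun _ => Uᴴ) * CStarMatrix.ofMatrix.symm M *
          Matrix.diagonal fun _ => U) := by
      rw [hD]
      rfl
    rw [hmul]
    refine CStarMatrix.ext fun i l => ?_
    rw [CStarMatrix.map_apply, CStarMatrix.ofMatrix_apply, Matrix.mul_diagonal,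
      Matrix.diagonal_mul]
    rfl
  rw [h]
  exact star_left_conjugate_nonneg hM D

open scoped MatrixOrder Matrix.Norms.L2Operator CStarAlgebra in
/-- The completely positive map `X ↦ ∑ j, t j • (U j)ᴴ X (U j)`. -/
noncomputable def MatrixCPMap.ofConjugations {n r : ℕ} (t : Fin r → ℝ) (ht : ∀ j, 0 ≤ t j)
    (U : Fin r → Matrix (Fin n) (Fin n) ℂ) : MatrixCPMap n n where
  toFun X := ∑ j, (t j : ℂ) • ((U j)ᴴ * X * U j)
  map_add' X Y := by
    simp only [mul_add, add_mul, smul_add, Finset.sum_add_distrib]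
  map_smul' c X := by
    simp only [mul_smul_comm, smul_mul_assoc, Finset.smul_sum, RingHom.id_apply]
    exact Finset.sum_congr rfl fun j _ => smul_comm _ _ _
  map_cstarMatrix_nonneg' k M hM := by
    have h : (M.map fun X => ∑ j, (t j : ℂ) • ((U j)ᴴ * X * U j)) =
        ∑ j, (t j : ℂ) • M.map (fun X => (U j)ᴴ * X * U j) := by
      refine CStarMatrix.ext fun i l => ?_
      exact (Matrix.sum_apply i l Finset.univ
        fun j => (t j : ℂ) • (M.map (fun X => (U j)ᴴ * X * U j) : Matrix _ _ _)).symm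
    change 0 ≤ M.map fun X => ∑ j, (t j : ℂ) • ((U j)ᴴ * X * U j)
    rw [h]
    refine Finset.sum_nonneg fun j _ => ?_
    open scoped ComplexOrder in
    exact smul_nonneg (by exact_mod_cast ht j) (CStarMatrix.map_conjugate_nonneg (U j) M hM)

theorem MatrixCPMap.ofConjugations_apply {n r : ℕ} (t : Fin r → ℝ) (ht : ∀ j, 0 ≤ t j)
    (U : Fin r → Matrix (Fin n) (Fin n) ℂ) (X : Matrix (Fin n) (Fin n) ℂ) :
    MatrixCPMap.ofConjugations t ht U X = ∑ j, (t j : ℂ) • ((U j)ᴴ * X * U j) := rfl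

open scoped ComplexOrder MatrixOrder Matrix.Norms.L2Operator CStarAlgebra in
theorem MatrixCPMap.map_posSemidef {n m : ℕ} (Φ : MatrixCPMap n m)
    {X : Matrix (Fin n) (Fin n) ℂ} (hX : X.PosSemidef) : (Φ X).PosSemidef := by
  have : 0 ≤ Φ X := map_nonneg Φ (Matrix.nonneg_iff_posSemidef.mpr hX)
  exact Matrix.nonneg_iff_posSemidef.mp this

theorem MatrixCPMap.map_sub' {n m : ℕ} (Φ : MatrixCPMap n m)
    (X Y : Matrix (Fin n) (Fin n) ℂ) : Φ (X - Y) = Φ X - Φ Y := map_sub Φ X Y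

theorem MatrixCPMap.map_smul' {n m : ℕ} (Φ : MatrixCPMap n m) (c : ℂ)
    (X : Matrix (Fin n) (Fin n) ℂ) : Φ (c • X) = c • Φ X := map_smul Φ c X

theorem trace_unitary_conj {n : ℕ} {U : Matrix (Fin n) (Fin n) ℂ}
    (hU : U ∈ Matrix.unitaryGroup (Fin n) ℂ) (X : Matrix (Fin n) (Fin n) ℂ) :
    (Uᴴ * X * U).trace = X.trace := by
  rw [Matrix.trace_mul_comm, ← mul_assoc, ← Matrix.star_eq_conjTranspose,
    Matrix.mem_unitaryGroup_iff.mp hU, one_mul]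

theorem MatrixCPMap.IsMixedUnitary.isUnital {n : ℕ} {Φ : MatrixCPMap n n}
    (h : Φ.IsMixedUnitary) : Φ.IsUnital := by
  obtain ⟨r, t, U, -, ht, hU, hΦ⟩ := h
  have h1 : ∀ j, (U j)ᴴ * 1 * U j = 1 := fun j => by
    rw [mul_one, ← Matrix.star_eq_conjTranspose, Matrix.mem_unitaryGroup_iff'.mp (hU j)]
  rw [MatrixCPMap.IsUnital, hΦ]
  simp only [h1, ← Finset.sum_smul, ← Complex.ofReal_sum, ht, Complex.ofReal_one, one_smul]

theorem MatrixCPMap.IsMixedUnitary.isTracePreserving {n : ℕ} {Φ : MatrixCPMap n n}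
    (h : Φ.IsMixedUnitary) : Φ.IsTracePreserving := by
  obtain ⟨r, t, U, -, ht, hU, hΦ⟩ := h
  intro X
  rw [hΦ, Matrix.trace_sum]
  simp only [Matrix.trace_smul, trace_unitary_conj (hU _), ← Finset.sum_smul,
    ← Complex.ofReal_sum, ht, Complex.ofReal_one, one_smul]

/-! ### Diagonalization -/

theorem permMatrix_mem_unitaryGroup {n : ℕ} (σ : Equiv.Perm (Fin n)) :
    σ.permMatrix ℂ ∈ Matrix.unitaryGroup (Fin n) ℂ := by
  rw [Matrix.mem_unitaryGroup_iff, Matrix.star_eq_conjTranspose, Matrix.conjTranspose_permMatrix,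
    ← Matrix.permMatrix_mul, inv_mul_cancel, Matrix.permMatrix_one]

theorem permMatrix_conj_diagonal {n : ℕ} (σ : Equiv.Perm (Fin n)) (d : Fin n → ℂ) :
    (σ.permMatrix ℂ)ᵀ * Matrix.diagonal d * σ.permMatrix ℂ =
      Matrix.diagonal (d ∘ σ.symm) := by
  rw [Matrix.transpose_permMatrix]
  ext i j
  simp [PEquiv.toMatrix_toPEquiv_mul, PEquiv.mul_toMatrix_toPEquiv, Matrix.diagonal_apply,
    Equiv.Perm.inv_def]

theorem conjTranspose_permMatrix_eq_transpose {n : ℕ} (σ : Equiv.Perm (Fin n)) :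
    (σ.permMatrix ℂ)ᴴ = (σ.permMatrix ℂ)ᵀ := by
  rw [Matrix.conjTranspose_permMatrix, Matrix.transpose_permMatrix]

/-- Equal multisets of values mean fibres of equal size; bijections between the fibres glue to a
permutation. -/
theorem exists_perm_of_map_univ_val_eq {α β : Type*} [Fintype α] [DecidableEq β] {f g : α → β}
    (h : Finset.univ.val.map f = Finset.univ.val.map g) : ∃ σ : Equiv.Perm α, f = g ∘ σ := by
  have hcard : ∀ y, Fintype.card {x // f x = y} = Fintype.card {x // g x = y} := fun y => by
    have := congrArg (Multiset.count y) h
    simp only [Multiset.count_map, eq_comm (a := y)] at this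
    rw [Fintype.card_subtype, Fintype.card_subtype]
    exact this
  refine ⟨Equiv.ofFiberEquiv fun y => Fintype.equivOfCardEq (hcard y), ?_⟩
  exact funext fun x => (Equiv.ofFiberEquiv_map _ x).symm

theorem Matrix.IsHermitian.exists_unitary_conj_eq_diagonal {n : ℕ}
    {A : Matrix (Fin n) (Fin n) ℂ} (hA : A.IsHermitian) {a : Fin n → ℝ}
    (ha : IsEigenvalueVector A a) :
    ∃ U ∈ Matrix.unitaryGroup (Fin n) ℂ, Uᴴ * A * U = Matrix.diagonal (fun i => (a i : ℂ)) := by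
  have h := hA.roots_charpoly_eq_eigenvalues
  rw [ha] at h
  obtain ⟨σ, hσ⟩ := exists_perm_of_map_univ_val_eq h
  have hU : (hA.eigenvectorUnitary : Matrix (Fin n) (Fin n) ℂ)ᴴ * A *
      (hA.eigenvectorUnitary : Matrix (Fin n) (Fin n) ℂ) =
      Matrix.diagonal (RCLike.ofReal ∘ hA.eigenvalues) := by
    simpa [Unitary.conjStarAlgAut_star_apply, Matrix.star_eq_conjTranspose] using
      hA.conjStarAlgAut_star_eigenvectorUnitary
  -- The spectral theorem lists the eigenvalues in its own order; the permutation matrix reorders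
  -- them to match `a`.
  refine ⟨hA.eigenvectorUnitary * σ⁻¹.permMatrix ℂ,
    mul_mem hA.eigenvectorUnitary.2 (permMatrix_mem_unitaryGroup _), ?_⟩
  have h2 := permMatrix_conj_diagonal σ⁻¹ (RCLike.ofReal ∘ hA.eigenvalues)
  rw [← hU] at h2
  rw [Matrix.conjTranspose_mul, conjTranspose_permMatrix_eq_transpose]
  simp only [mul_assoc] at h2 ⊢
  rw [h2, hσ]
  rfl

theorem eq_of_unitary_conj {n : ℕ} {U A C : Matrix (Fin n) (Fin n) ℂ}
    (hU : U ∈ Matrix.unitaryGroup (Fin n) ℂ) (h : Uᴴ * A * U = C) : A = U * C * Uᴴ := by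
  have h1 : U * Uᴴ = 1 := Matrix.mem_unitaryGroup_iff.mp hU
  rw [← h, ← mul_assoc, ← mul_assoc, h1, one_mul, mul_assoc, h1, mul_one]

theorem conjTranspose_mem_unitaryGroup {n : ℕ} {U : Matrix (Fin n) (Fin n) ℂ}
    (hU : U ∈ Matrix.unitaryGroup (Fin n) ℂ) : Uᴴ ∈ Matrix.unitaryGroup (Fin n) ℂ :=
  Unitary.star_mem hU

/-! ### The individual implications -/

theorem diagonal_eq_sum_permMatrix_conj {n r : ℕ} {a b : Fin n → ℝ}
    {t : Fin r → ℝ} {σ : Fin r → Equiv.Perm (Fin n)}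
    (h : b = a ᵥ* ∑ l, t l • (σ l).permMatrix ℝ) :
    Matrix.diagonal (fun i => (b i : ℂ)) = ∑ l, (t l : ℂ) •
      (((σ l).permMatrix ℂ)ᵀ * Matrix.diagonal (fun i => (a i : ℂ)) * (σ l).permMatrix ℂ) := by
  have hb : ∀ i, b i = ∑ l, t l * a ((σ l).symm i) := fun i => by
    rw [h, Matrix.vecMul_sum, Finset.sum_apply]
    simp [Matrix.vecMul_smul, Matrix.vecMul_permMatrix]
  ext i j
  simp only [permMatrix_conj_diagonal, Matrix.sum_apply, Matrix.smul_apply, Matrix.diagonal_apply,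
    hb]
  split_ifs <;> simp

/-- A doubly stochastic relation between eigenvalues, as a mixture of unitary conjugations. -/
theorem eq_sum_permMatrix_conj {n r : ℕ} {A B U V : Matrix (Fin n) (Fin n) ℂ} {a b : Fin n → ℝ}
    {t : Fin r → ℝ} {σ : Fin r → Equiv.Perm (Fin n)}
    (h : b = a ᵥ* ∑ l, t l • (σ l).permMatrix ℝ)
    (hV : V ∈ Matrix.unitaryGroup (Fin n) ℂ)
    (hUA : Uᴴ * A * U = Matrix.diagonal (fun i => (a i : ℂ)))
    (hVB : V * B * Vᴴ = Matrix.diagonal (fun i => (b i : ℂ))) :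
    B = ∑ l, (t l : ℂ) •
      (Vᴴ * ((σ l).permMatrix ℂ)ᵀ * Uᴴ * A * U * (σ l).permMatrix ℂ * V) := by
  rw [← Matrix.conjTranspose_conjTranspose V] at hVB
  rw [Matrix.conjTranspose_conjTranspose (Vᴴ)] at hVB
  have hB := eq_of_unitary_conj (conjTranspose_mem_unitaryGroup hV) hVB
  rw [hB, diagonal_eq_sum_permMatrix_conj h, ← hUA, Matrix.conjTranspose_conjTranspose]
  simp only [Finset.mul_sum, Finset.sum_mul, mul_smul_comm, smul_mul_assoc, mul_assoc]

/-- Used to drop the zero weights in Birkhoff's decomposition, since mixed unitary maps require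
strictly positive ones. -/
theorem sum_equiv_subtype_ne_zero {α ι M : Type*} [Fintype α] [Fintype ι] [AddCommMonoid M]
    {w : α → ℝ} (e : ι ≃ {x // w x ≠ 0}) (f : α → M) (hf : ∀ x, w x = 0 → f x = 0) :
    ∑ l, f (e l) = ∑ x, f x := by
  classical
  rw [Equiv.sum_comp e fun x => f x, ← Finset.sum_subtype (Finset.univ.filter fun x => w x ≠ 0)
    (by simp) f]
  exact Finset.sum_filter_of_ne fun x _ hx h => hx (hf x h)

theorem exists_pos_sum_permMatrix_of_mem_doublyStochastic {n : ℕ} {D : Matrix (Fin n) (Fin n) ℝ}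
    (hD : D ∈ doublyStochastic ℝ (Fin n)) :
    ∃ (r : ℕ) (t : Fin r → ℝ) (σ : Fin r → Equiv.Perm (Fin n)),
      (∀ l, 0 < t l) ∧ ∑ l, t l = 1 ∧ D = ∑ l, t l • (σ l).permMatrix ℝ := by
  obtain ⟨w, hw0, hw1, hwD⟩ := exists_eq_sum_perm_of_mem_doublyStochastic hD
  let e := (Fintype.equivFin {σ // w σ ≠ 0}).symm
  refine ⟨Fintype.card {σ // w σ ≠ 0}, fun l => w (e l), fun l => e l,
    fun l => (hw0 _).lt_of_ne' (e l).2, ?_, ?_⟩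
  · rw [← hw1]
    exact sum_equiv_subtype_ne_zero e w fun σ h => h
  · rw [← hwD]
    exact (sum_equiv_subtype_ne_zero e (fun σ => w σ • σ.permMatrix ℝ)
      fun σ h => by rw [h, zero_smul]).symm

theorem exists_isMixedUnitary_of_doublyStochastic {n : ℕ} {A B : Matrix (Fin n) (Fin n) ℂ}
    (hA : A.IsHermitian) (hB : B.IsHermitian) {a b : Fin n → ℝ}
    (ha : IsEigenvalueVector A a) (hb : IsEigenvalueVector B b)
    {D : Matrix (Fin n) (Fin n) ℝ} (hD : D ∈ doublyStochastic ℝ (Fin n)) (h : b = a ᵥ* D) :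
    ∃ Φ : MatrixCPMap n n, Φ.IsMixedUnitary ∧ Φ A = B := by
  obtain ⟨U, hU, hUA⟩ := hA.exists_unitary_conj_eq_diagonal ha
  obtain ⟨V, hV, hVB⟩ := hB.exists_unitary_conj_eq_diagonal hb
  obtain ⟨r, t, σ, ht, ht1, rfl⟩ := exists_pos_sum_permMatrix_of_mem_doublyStochastic hD
  have hV' := conjTranspose_mem_unitaryGroup hV
  have hVB' : Vᴴ * B * Vᴴᴴ = Matrix.diagonal (fun i => (b i : ℂ)) := by
    rwa [Matrix.conjTranspose_conjTranspose]
  refine ⟨MatrixCPMap.ofConjugations t (fun j => (ht j).le)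
    fun l => U * (σ l).permMatrix ℂ * Vᴴ, ⟨r, t, _, ht, ht1, fun l => ?_, fun X => rfl⟩, ?_⟩
  · exact mul_mem (mul_mem hU (permMatrix_mem_unitaryGroup _)) hV'
  · rw [MatrixCPMap.ofConjugations_apply]
    conv_rhs => rw [eq_sum_permMatrix_conj h hV' hUA hVB']
    simp only [Matrix.conjTranspose_mul, conjTranspose_permMatrix_eq_transpose, mul_assoc]

open scoped ComplexOrder in
theorem sum_max_le_of_isTracePreserving {n : ℕ} {A B : Matrix (Fin n) (Fin n) ℂ}
    (hA : A.IsHermitian) (hB : B.IsHermitian) {a b : Fin n → ℝ}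
    (ha : IsEigenvalueVector A a) (hb : IsEigenvalueVector B b) {t : ℝ}
    {Φ : MatrixCPMap n n} (hΦ : Φ.IsTracePreserving)
    (h : Φ (A - (t : ℂ) • 1) = B - (t : ℂ) • 1) :
    ∑ i, max (b i - t) 0 ≤ ∑ i, max (a i - t) 0 := by
  obtain ⟨U, hU, hUA⟩ := hA.exists_unitary_conj_eq_diagonal ha
  obtain ⟨V, hV, hVB⟩ := hB.exists_unitary_conj_eq_diagonal hb
  have hUU : U * Uᴴ = 1 := Matrix.mem_unitaryGroup_iff.mp hU
  have hVV : Vᴴ * V = 1 := Matrix.mem_unitaryGroup_iff'.mp hV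
  let P := U * Matrix.diagonal (fun i => ((max (a i - t) 0 : ℝ) : ℂ)) * Uᴴ
  let N := U * Matrix.diagonal (fun i => ((max (t - a i) 0 : ℝ) : ℂ)) * Uᴴ
  have hpos : ∀ d : Fin n → ℝ, (∀ i, 0 ≤ d i) →
      (U * Matrix.diagonal (fun i => (d i : ℂ)) * Uᴴ).PosSemidef := fun d hd => by
    exact (Matrix.PosSemidef.diagonal fun i => by simpa using hd i).mul_mul_conjTranspose_same U
  have hPN : A - (t : ℂ) • 1 = P - N := by
    rw [eq_of_unitary_conj hU hUA, ← sub_mul, ← mul_sub]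
    have h1 : (t : ℂ) • (1 : Matrix (Fin n) (Fin n) ℂ) =
        U * Matrix.diagonal (fun _ => (t : ℂ)) * Uᴴ := by
      rw [← Matrix.smul_one_eq_diagonal, mul_smul_comm, smul_mul_assoc, mul_one, hUU]
    rw [h1, ← sub_mul, ← mul_sub, Matrix.diagonal_sub, Matrix.diagonal_sub]
    congr 3
    funext i
    norm_cast
    rcases le_total (a i) t with h | h
    · rw [max_eq_right (by linarith), max_eq_left (by linarith)]; ring
    · rw [max_eq_left (by linarith), max_eq_right (by linarith)]; ring
  -- Both `Φ P` and `Φ N` get nonnegative diagonals in the eigenbasis of `B`: the second gives `b i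
  -- - t` as a lower bound for the diagonal of `Φ P`, the first gives `0`.
  have hdiag : ∀ {X : Matrix (Fin n) (Fin n) ℂ}, X.PosSemidef → ∀ i,
      0 ≤ ((Vᴴ * Φ X * V) i i).re := fun hX i => by
    have := ((Φ.map_posSemidef hX).conjTranspose_mul_mul_same V).diag_nonneg (i := i)
    exact (Complex.le_def.mp this).1
  have hsub : Vᴴ * Φ P * V - Vᴴ * Φ N * V =
      Matrix.diagonal (fun i => (b i : ℂ)) - (t : ℂ) • 1 := by
    rw [← sub_mul, ← mul_sub, ← MatrixCPMap.map_sub', ← hPN, h, mul_sub, sub_mul, hVB,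
      mul_smul_comm, smul_mul_assoc, mul_one, hVV]
  have hentry : ∀ i, max (b i - t) 0 ≤ ((Vᴴ * Φ P * V) i i).re := fun i => by
    have h1 := congrArg Complex.re (congrFun (congrFun hsub i) i)
    simp only [Matrix.sub_apply, Matrix.diagonal_apply_eq, Matrix.smul_apply, Matrix.one_apply_eq,
      Complex.sub_re, smul_eq_mul, mul_one, Complex.ofReal_re] at h1
    have h2 := hdiag (hpos (fun i => max (t - a i) 0) fun i => le_max_right _ _) i
    exact max_le (by linarith) (hdiag (hpos (fun i => max (a i - t) 0) fun i => le_max_right _ _) i)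
  calc _ ≤ ∑ i, ((Vᴴ * Φ P * V) i i).re := Finset.sum_le_sum fun i _ => hentry i
    _ = (Vᴴ * Φ P * V).trace.re := by simp [Matrix.trace, Matrix.diag]
    _ = P.trace.re := by rw [trace_unitary_conj hV, hΦ]
    _ = _ := by
      rw [Matrix.trace_mul_comm, ← mul_assoc, ← Matrix.star_eq_conjTranspose,
        Matrix.mem_unitaryGroup_iff'.mp hU, one_mul]
      simp [Matrix.trace, Matrix.diag]

theorem trace_eq_sum_of_isEigenvalueVector {n : ℕ} {A : Matrix (Fin n) (Fin n) ℂ}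
    {a : Fin n → ℝ} (ha : IsEigenvalueVector A a) : A.trace = ((∑ i, a i : ℝ) : ℂ) := by
  rw [Matrix.trace_eq_sum_roots_charpoly, ha]
  simp [List.sum_ofFn]

theorem isMajorizedBy_of_isTracePreserving {n : ℕ} {A B : Matrix (Fin n) (Fin n) ℂ}
    (hA : A.IsHermitian) (hB : B.IsHermitian) {a b : Fin n → ℝ}
    (ha : IsEigenvalueVector A a) (hb : IsEigenvalueVector B b)
    (h : ∀ t : ℝ, ∃ Φ : MatrixCPMap n n, Φ.IsTracePreserving ∧
      Φ (A - (t : ℂ) • (1 : Matrix (Fin n) (Fin n) ℂ)) =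
        B - (t : ℂ) • (1 : Matrix (Fin n) (Fin n) ℂ)) : IsMajorizedBy b a := by
  refine (isMajorizedBy_iff_sum_max b a).mpr ⟨fun t => ?_, ?_⟩
  · obtain ⟨Φ, hΦ, hΦA⟩ := h t
    exact sum_max_le_of_isTracePreserving hA hB ha hb hΦ hΦA
  · obtain ⟨Φ, hΦ, hΦA⟩ := h 0
    rw [Complex.ofReal_zero, zero_smul, sub_zero, sub_zero] at hΦA
    have := hΦ A
    rw [hΦA, trace_eq_sum_of_isEigenvalueVector ha, trace_eq_sum_of_isEigenvalueVector hb] at this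
    exact_mod_cast this.symm

theorem exists_doublyStochastic_of_diag_eq {n : ℕ} {a b : Fin n → ℝ}
    {W : Matrix (Fin n) (Fin n) ℂ} (hW : W ∈ Matrix.unitaryGroup (Fin n) ℂ)
    (h : ∀ i, (W * Matrix.diagonal (fun j => (a j : ℂ)) * Wᴴ) i i = (b i : ℂ)) :
    ∃ D ∈ doublyStochastic ℝ (Fin n), b = a ᵥ* D := by
  -- The indices are transposed because `a` acts as a row vector.
  refine ⟨Matrix.of fun i j => Complex.normSq (W j i), ?_, ?_⟩
  · rw [mem_doublyStochastic_iff_sum]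
    refine ⟨fun i j => Complex.normSq_nonneg _, fun i => ?_, fun j => ?_⟩
    · have h1 := congrFun (congrFun (Matrix.mem_unitaryGroup_iff'.mp hW) i) i
      rw [Matrix.mul_apply, Matrix.one_apply_eq] at h1
      simp only [Matrix.star_apply, Complex.star_def, ← Complex.normSq_eq_conj_mul_self] at h1
      exact_mod_cast h1
    · have h1 := congrFun (congrFun (Matrix.mem_unitaryGroup_iff.mp hW) j) j
      rw [Matrix.mul_apply, Matrix.one_apply_eq] at h1
      simp only [Matrix.star_apply, Complex.star_def, Complex.mul_conj] at h1
      exact_mod_cast h1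
  · funext i
    have h1 := h i
    rw [Matrix.mul_apply] at h1
    simp only [Matrix.mul_diagonal, Matrix.conjTranspose_apply, Complex.star_def] at h1
    have h2 : ∀ j, W i j * (a j : ℂ) * (starRingEnd ℂ) (W i j) =
        ((a j * Complex.normSq (W i j) : ℝ) : ℂ) := fun j => by
      rw [mul_right_comm, Complex.mul_conj]
      push_cast
      ring
    simp only [h2] at h1
    rw [Matrix.vecMul, dotProduct]
    exact_mod_cast h1.symm

/-- Conjugation by the diagonal unitary with entries `ζ ^ (i * j)` multiplies entry `(k, l)` by the
`j`-th power of an `n`-th root of unity, which is `1` only when `k = l`. Summing over `j` kills the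
off-diagonal entries. -/
theorem exists_average_eq_diagonal_diag {n : ℕ} (X : Matrix (Fin n) (Fin n) ℂ) :
    ∃ Z : Fin n → Matrix (Fin n) (Fin n) ℂ, (∀ j, Z j ∈ Matrix.unitaryGroup (Fin n) ℂ) ∧
      Matrix.diagonal X.diag = (1 / (n : ℂ)) • ∑ j, (Z j)ᴴ * X * Z j := by
  rcases n.eq_zero_or_pos with rfl | hn
  · exact ⟨fun _ => 1, fun _ => one_mem _, Subsingleton.elim _ _⟩
  have hn0 : (n : ℂ) ≠ 0 := by exact_mod_cast hn.ne'
  let ζ : ℂ := Complex.exp (2 * Real.pi * Complex.I / n)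
  have hζ : IsPrimitiveRoot ζ n := Complex.isPrimitiveRoot_exp n hn.ne'
  have hnorm : ζ * (starRingEnd ℂ) ζ = 1 := by
    rw [Complex.mul_conj, Complex.normSq_eq_norm_sq, hζ.norm'_eq_one hn.ne']
    simp
  have hsum : ∀ k l : Fin n, ∑ j : Fin n,
      ((starRingEnd ℂ) ζ ^ (k : ℕ) * ζ ^ (l : ℕ)) ^ (j : ℕ) = if k = l then (n : ℂ) else 0 := by
    intro k l
    split_ifs with h
    · rw [h, ← mul_pow, mul_comm, hnorm]
      simp
    · have hpow : ((starRingEnd ℂ) ζ ^ (k : ℕ) * ζ ^ (l : ℕ)) ^ n = 1 := by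
        rw [mul_pow, ← pow_mul, ← pow_mul, mul_comm (k : ℕ), mul_comm (l : ℕ), pow_mul, pow_mul,
          ← map_pow, hζ.pow_eq_one]
        simp
      have hne : (starRingEnd ℂ) ζ ^ (k : ℕ) * ζ ^ (l : ℕ) ≠ 1 := fun h1 => h <| by
        have h2 : ζ ^ (k : ℕ) = ζ ^ (l : ℕ) := by
          rw [← mul_one (ζ ^ (k : ℕ)), ← h1, ← mul_assoc, ← mul_pow, hnorm, one_pow, one_mul]
        exact Fin.ext (hζ.pow_inj k.2 l.2 h2)
      have hgeom := geom_sum_mul ((starRingEnd ℂ) ζ ^ (k : ℕ) * ζ ^ (l : ℕ)) n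
      rw [hpow, sub_self, ← Fin.sum_univ_eq_sum_range] at hgeom
      exact (mul_eq_zero.mp hgeom).resolve_right (sub_ne_zero.mpr hne)
  refine ⟨fun j => Matrix.diagonal fun i => ζ ^ ((i : ℕ) * (j : ℕ)), fun j => ?_, ?_⟩
  · rw [Matrix.mem_unitaryGroup_iff, Matrix.star_eq_conjTranspose, Matrix.diagonal_conjTranspose,
      Matrix.diagonal_mul_diagonal, ← Matrix.diagonal_one]
    congr 1
    funext i
    rw [Pi.star_apply, Complex.star_def, map_pow, ← mul_pow, hnorm, one_pow]
  · ext k l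
    have hterm : ∀ j : Fin n, ((Matrix.diagonal fun i : Fin n => ζ ^ ((i : ℕ) * (j : ℕ)))ᴴ * X *
        Matrix.diagonal fun i : Fin n => ζ ^ ((i : ℕ) * (j : ℕ))) k l =
        ((starRingEnd ℂ) ζ ^ (k : ℕ) * ζ ^ (l : ℕ)) ^ (j : ℕ) * X k l := fun j => by
      rw [Matrix.diagonal_conjTranspose, Matrix.mul_diagonal, Matrix.diagonal_mul, Pi.star_apply,
        Complex.star_def, map_pow, pow_mul, pow_mul, mul_pow]
      ring
    rw [Matrix.smul_apply, Matrix.sum_apply]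
    simp only [hterm]
    rw [← Finset.sum_mul, hsum, Matrix.diagonal_apply, smul_eq_mul]
    split_ifs with h
    · subst h
      rw [Matrix.diag_apply, ← mul_assoc, one_div, inv_mul_cancel₀ hn0, one_mul]
    · simp

theorem exists_average_of_diag_eq {n : ℕ} {A B : Matrix (Fin n) (Fin n) ℂ}
    (hA : A.IsHermitian) (hB : B.IsHermitian) {a b : Fin n → ℝ}
    (ha : IsEigenvalueVector A a) (hb : IsEigenvalueVector B b)
    {W : Matrix (Fin n) (Fin n) ℂ} (hW : W ∈ Matrix.unitaryGroup (Fin n) ℂ)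
    (h : ∀ i, (W * Matrix.diagonal (fun j => (a j : ℂ)) * Wᴴ) i i = (b i : ℂ)) :
    ∃ U : Fin n → Matrix (Fin n) (Fin n) ℂ,
      (∀ j, U j ∈ Matrix.unitaryGroup (Fin n) ℂ) ∧
        B = (1 / (n : ℂ)) • ∑ j, (U j)ᴴ * A * U j := by
  obtain ⟨U, hU, hUA⟩ := hA.exists_unitary_conj_eq_diagonal ha
  obtain ⟨V, hV, hVB⟩ := hB.exists_unitary_conj_eq_diagonal hb
  obtain ⟨Z, hZ, hZX⟩ :=
    exists_average_eq_diagonal_diag (W * Matrix.diagonal (fun j => (a j : ℂ)) * Wᴴ)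
  have hdiag : (W * Matrix.diagonal (fun j => (a j : ℂ)) * Wᴴ).diag = fun i => (b i : ℂ) :=
    funext h
  refine ⟨fun j => U * Wᴴ * Z j * Vᴴ, fun j => mul_mem (mul_mem (mul_mem hU
    (conjTranspose_mem_unitaryGroup hW)) (hZ j)) (conjTranspose_mem_unitaryGroup hV), ?_⟩
  rw [eq_of_unitary_conj hV hVB, ← hdiag, hZX, ← hUA]
  simp only [Matrix.conjTranspose_mul, Matrix.conjTranspose_conjTranspose, Finset.mul_sum,
    Finset.sum_mul, mul_smul_comm, smul_mul_assoc, mul_assoc]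

theorem exists_isMixedUnitary_of_average {n : ℕ} {A B : Matrix (Fin n) (Fin n) ℂ}
    {U : Fin n → Matrix (Fin n) (Fin n) ℂ} (hU : ∀ j, U j ∈ Matrix.unitaryGroup (Fin n) ℂ)
    (h : B = (1 / (n : ℂ)) • ∑ j, (U j)ᴴ * A * U j) :
    ∃ Φ : MatrixCPMap n n, Φ.IsMixedUnitary ∧ Φ A = B := by
  -- For `n = 0` the `n` given unitaries form an empty family, whose weights cannot sum to `1`.
  rcases n.eq_zero_or_pos with rfl | hn
  · exact ⟨MatrixCPMap.ofConjugations (r := 1) (fun _ => 1) (fun _ => zero_le_one) fun _ => 1,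
      ⟨1, _, _, fun _ => zero_lt_one, by simp, fun _ => one_mem _, fun X => rfl⟩,
      Subsingleton.elim _ _⟩
  have hn' : (0 : ℝ) < n := by exact_mod_cast hn
  refine ⟨MatrixCPMap.ofConjugations (fun _ => 1 / (n : ℝ)) (fun _ => by positivity) U,
    ⟨n, _, U, fun _ => by positivity, by simp [hn'.ne'], hU, fun X => rfl⟩, ?_⟩
  rw [MatrixCPMap.ofConjugations_apply, h, Finset.smul_sum]
  push_cast
  rfl

/-! ### The Schur–Horn theorem: prescribing the diagonal -/

/-- Removing the largest entry `b p` from the majorized side, and merging two neighbouring entries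
`a q ≤ b p ≤ a p` of the majorizing side into `a p + a q - b p`, preserves the domination of
truncated sums. -/
theorem sum_max_erase_le {ι : Type*} [DecidableEq ι] {R : Finset ι} {p q : ι} (hp : p ∉ R)
    (hq : q ∈ R) {a b : ι → ℝ}
    (hdom : ∀ t : ℝ, ∑ i ∈ insert p R, max (b i - t) 0 ≤ ∑ i ∈ insert p R, max (a i - t) 0)
    (hmax : ∀ i ∈ R, b i ≤ b p) (hpa : b p ≤ a p) (hqa : a q ≤ b p)
    (hgap : ∀ i ∈ R, i ≠ q → b p ≤ a i ∨ a i ≤ a q) (t : ℝ) :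
    ∑ i ∈ R, max (b i - t) 0 ≤
      ∑ i ∈ R.erase q, max (a i - t) 0 + max (a p + a q - b p - t) 0 := by
  have hdom' : ∀ t : ℝ, max (b p - t) 0 + ∑ i ∈ R, max (b i - t) 0 ≤
      max (a p - t) 0 + (max (a q - t) 0 + ∑ i ∈ R.erase q, max (a i - t) 0) := fun t => by
    have := hdom t
    rwa [Finset.sum_insert hp, Finset.sum_insert hp,
      ← Finset.add_sum_erase R (fun i => max (a i - t) 0) hq] at this
  have hc := le_max_left (a p + a q - b p - t) 0
  have hc0 := le_max_right (a p + a q - b p - t) 0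
  have ha0 : 0 ≤ ∑ i ∈ R.erase q, max (a i - t) 0 :=
    Finset.sum_nonneg fun i _ => le_max_right _ _
  rcases le_or_gt (b p) t with htb | htb
  · rw [Finset.sum_eq_zero fun i hi => max_eq_right (by linarith [hmax i hi])]
    linarith
  -- Below `a q` the three special truncations are linear, and `(a p - t) + (a q - t) - (b p - t)`
  -- is exactly the merged term.
  rcases le_or_gt t (a q) with htq | htq
  · have h1 := hdom' t
    rw [max_eq_left (by linarith : 0 ≤ b p - t), max_eq_left (by linarith : 0 ≤ a p - t),
      max_eq_left (by linarith : 0 ≤ a q - t)] at h1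
    linarith
  -- Now `a q < t < b p`. By `hgap` no remaining `a i` lies strictly between `a q` and `b p`, so the
  -- truncated sum over `R.erase q` is linear on that interval, with slope minus the size of `M`.
  set M := (R.erase q).filter fun i => b p ≤ a i
  set K := R.filter fun i => t < b i
  have hM : ∀ s, a q ≤ s → s ≤ b p →
      ∑ i ∈ R.erase q, max (a i - s) 0 = ∑ i ∈ M, (a i - s) := fun s hs hs' => by
    rw [Finset.sum_filter]
    refine Finset.sum_congr rfl fun i hi => ?_
    split_ifs with h
    · exact max_eq_left (by linarith)
    · have := (hgap i (Finset.mem_of_mem_erase hi) (Finset.ne_of_mem_erase hi)).resolve_left h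
      exact max_eq_right (by linarith)
  have hK : ∑ i ∈ R, max (b i - t) 0 = ∑ i ∈ K, (b i - t) := by
    rw [Finset.sum_filter]
    refine Finset.sum_congr rfl fun i _ => ?_
    split_ifs with h
    · exact max_eq_left (by linarith)
    · exact max_eq_right (by linarith)
  rw [hM t htq.le htb.le, hK]
  -- If `K` has at most as many elements as `M`, entries compare through `b p`: each `b i` is at
  -- most `b p`, and each `a i` with `i ∈ M` is at least `b p`.
  rcases le_or_gt K.card M.card with hcard | hcard
  · have h1 : ∑ i ∈ K, (b i - t) ≤ K.card * (b p - t) := by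
      rw [← nsmul_eq_mul]
      exact Finset.sum_le_card_nsmul _ _ _ fun i hi => by
        linarith [hmax i (Finset.mem_filter.mp hi).1]
    have h2 : (M.card : ℝ) * (b p - t) ≤ ∑ i ∈ M, (a i - t) := by
      rw [← nsmul_eq_mul]
      exact Finset.card_nsmul_le_sum _ _ _ fun i hi => by
        linarith [(Finset.mem_filter.mp hi).2]
    have h3 : (K.card : ℝ) * (b p - t) ≤ M.card * (b p - t) :=
      mul_le_mul_of_nonneg_right (by exact_mod_cast hcard) (by linarith)
    linarith
  -- Otherwise start from domination at `a q` and raise the level to `t`: the left side drops by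
  -- `K.card * (t - a q)`, the right side by only `(M.card + 1) * (t - a q)`, the merged term
  -- included.
  · have h1 := hdom' (a q)
    rw [max_eq_left (by linarith : 0 ≤ b p - a q), max_eq_left (by linarith : 0 ≤ a p - a q),
      hM (a q) le_rfl hqa, sub_self, max_self] at h1
    have h2 : ∑ i ∈ K, (b i - a q) ≤ ∑ i ∈ R, max (b i - a q) 0 :=
      (Finset.sum_le_sum fun i _ => le_max_left _ _).trans
        (Finset.sum_le_sum_of_subset_of_nonneg (Finset.filter_subset _ _)
          fun i _ _ => le_max_right _ _)
    simp only [Finset.sum_sub_distrib, Finset.sum_const, nsmul_eq_mul] at h1 h2 ⊢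
    have h3 : ((M.card : ℝ) + 1) * (t - a q) ≤ K.card * (t - a q) :=
      mul_le_mul_of_nonneg_right (by exact_mod_cast hcard) (by linarith)
    linarith

/-! ### Plane rotations and their effect on diagonal matrices -/

/-- The rotation with cosine `c` and sine `s` in the plane of the coordinates `p` and `q`. -/
noncomputable def planeRotation {n : ℕ} (p q : Fin n) (c s : ℝ) : Matrix (Fin n) (Fin n) ℂ :=
  Matrix.of fun i k =>
    if i = p then (if p = k then (c : ℂ) else 0) + (if q = k then (s : ℂ) else 0)
    else if i = q then (if p = k then (-s : ℂ) else 0) + (if q = k then (c : ℂ) else 0)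
    else if i = k then 1 else 0

theorem planeRotation_mul_apply {n : ℕ} (p q : Fin n) (c s : ℝ) (X : Matrix (Fin n) (Fin n) ℂ)
    (i j : Fin n) : (planeRotation p q c s * X) i j =
      if i = p then c * X p j + s * X q j else if i = q then -s * X p j + c * X q j
      else X i j := by
  rw [Matrix.mul_apply]
  simp only [planeRotation, Matrix.of_apply]
  split_ifs <;> simp [add_mul, Finset.sum_add_distrib]

theorem mul_conjTranspose_planeRotation_apply {n : ℕ} (p q : Fin n) (c s : ℝ)
    (X : Matrix (Fin n) (Fin n) ℂ) (i j : Fin n) : (X * (planeRotation p q c s)ᴴ) i j =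
      if j = p then c * X i p + s * X i q else if j = q then -s * X i p + c * X i q
      else X i j := by
  rw [← Matrix.conjTranspose_conjTranspose X, ← Matrix.conjTranspose_mul,
    Matrix.conjTranspose_apply, planeRotation_mul_apply]
  split_ifs <;> simp

theorem planeRotation_mem_unitaryGroup {n : ℕ} {p q : Fin n} (hpq : p ≠ q) {c s : ℝ}
    (hcs : c ^ 2 + s ^ 2 = 1) : planeRotation p q c s ∈ Matrix.unitaryGroup (Fin n) ℂ := by
  have hcs' : (c : ℂ) ^ 2 + (s : ℂ) ^ 2 = 1 := by exact_mod_cast hcs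
  rw [Matrix.mem_unitaryGroup_iff, Matrix.star_eq_conjTranspose,
    ← mul_one (planeRotation p q c s)]
  ext i j
  rw [mul_one, ← one_mul (planeRotation p q c s)ᴴ, planeRotation_mul_apply]
  simp only [mul_conjTranspose_planeRotation_apply, Matrix.one_apply]
  have hqp := hpq.symm
  by_cases hip : i = p <;> by_cases hiq : i = q <;> by_cases hjp : j = p <;>
    by_cases hjq : j = q <;> simp_all [eq_comm (b := j)] <;>
    first | linear_combination hcs' | ring

/-- The `{p, q}` block keeps its trace, which forces the second diagonal entry. The value of `e` is
irrelevant later. -/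
theorem planeRotation_conj_diagonal {n : ℕ} {p q : Fin n} (hpq : p ≠ q) {c s : ℝ}
    (hcs : c ^ 2 + s ^ 2 = 1) {a : Fin n → ℝ} {β : ℝ} (hβ : c ^ 2 * a p + s ^ 2 * a q = β) :
    ∃ e : ℂ, planeRotation p q c s * Matrix.diagonal (fun i => (a i : ℂ)) *
        (planeRotation p q c s)ᴴ =
      Matrix.diagonal (fun i =>
        (Function.update (Function.update a p β) q (a p + a q - β) i : ℂ)) +
      Matrix.single p q e + Matrix.single q p e := by
  refine ⟨c * s * (a q - a p), ?_⟩
  have hβ' : (β : ℂ) = c ^ 2 * a p + s ^ 2 * a q := by exact_mod_cast hβ.symm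
  have hcs' : (c : ℂ) ^ 2 + (s : ℂ) ^ 2 = 1 := by exact_mod_cast hcs
  clear hβ hcs
  have hqp := hpq.symm
  ext i j
  rw [mul_assoc, planeRotation_mul_apply]
  simp only [mul_conjTranspose_planeRotation_apply, Matrix.add_apply, Matrix.single_apply,
    Matrix.diagonal_apply]
  simp only [eq_comm (a := p) (b := i), eq_comm (a := q) (b := i), eq_comm (a := p) (b := j),
    eq_comm (a := q) (b := j)]
  by_cases hip : i = p <;> by_cases hiq : i = q <;> by_cases hjp : j = p <;>
    by_cases hjq : j = q <;> simp_all <;>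
    first
    | ring1
    | linear_combination (a p + a q : ℂ) * hcs'
    | exact fun h => absurd h.symm (by assumption)

theorem mul_single_mul_apply {n : ℕ} (W X : Matrix (Fin n) (Fin n) ℂ) (p q i j : Fin n) (e : ℂ) :
    (W * Matrix.single p q e * X) i j = W i p * e * X q j := by
  rw [Matrix.mul_apply, Finset.sum_eq_single q]
  · rw [Matrix.mul_single_apply_same]
  · intro k _ hk
    rw [Matrix.mul_single_apply_of_ne _ _ _ _ _ hk, zero_mul]
  · simp

/-! ### Unitaries confined to a set of coordinates, and the induction -/

/-- `W` acts as the identity on the coordinates outside `S`. -/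
def Matrix.IsSupportedOn {n : ℕ} (W : Matrix (Fin n) (Fin n) ℂ) (S : Finset (Fin n)) : Prop :=
  ∀ i ∉ S, ∀ j, W i j = (1 : Matrix (Fin n) (Fin n) ℂ) i j ∧
    W j i = (1 : Matrix (Fin n) (Fin n) ℂ) j i

theorem Matrix.IsSupportedOn.mul {n : ℕ} {W X : Matrix (Fin n) (Fin n) ℂ} {S : Finset (Fin n)}
    (hW : W.IsSupportedOn S) (hX : X.IsSupportedOn S) : (W * X).IsSupportedOn S := by
  intro i hi j
  constructor
  · rw [Matrix.mul_apply]
    simp only [(hW i hi _).1, Matrix.one_apply, ite_mul, one_mul, zero_mul, Finset.sum_ite_eq,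
      Finset.mem_univ, if_true, (hX i hi j).1]
  · rw [Matrix.mul_apply]
    simp only [(hX i hi _).2, Matrix.one_apply, mul_ite, mul_one, mul_zero, Finset.sum_ite_eq',
      Finset.mem_univ, if_true, (hW i hi j).2]

theorem Matrix.IsSupportedOn.mono {n : ℕ} {W : Matrix (Fin n) (Fin n) ℂ} {S T : Finset (Fin n)}
    (hW : W.IsSupportedOn S) (h : S ⊆ T) : W.IsSupportedOn T :=
  fun i hi => hW i fun hS => hi (h hS)

theorem isSupportedOn_planeRotation {n : ℕ} {p q : Fin n} {S : Finset (Fin n)} (hp : p ∈ S)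
    (hq : q ∈ S) (c s : ℝ) : (planeRotation p q c s).IsSupportedOn S := by
  intro i hi j
  have hip : i ≠ p := fun h => hi (h ▸ hp)
  have hiq : i ≠ q := fun h => hi (h ▸ hq)
  simp only [planeRotation, Matrix.of_apply, Matrix.one_apply]
  refine ⟨by simp [hip, hiq], ?_⟩
  split_ifs <;> simp_all

theorem isSupportedOn_permMatrix_swap {n : ℕ} {p q : Fin n} {S : Finset (Fin n)} (hp : p ∈ S)
    (hq : q ∈ S) : ((Equiv.swap p q).permMatrix ℂ).IsSupportedOn S := by
  intro i hi j
  have hip : i ≠ p := fun h => hi (h ▸ hp)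
  have hiq : i ≠ q := fun h => hi (h ▸ hq)
  constructor
  · simp [PEquiv.toMatrix_apply, Matrix.one_apply, Equiv.swap_apply_of_ne_of_ne hip hiq]
  · have h := Equiv.swap_apply_eq_iff (x := p) (y := q) (z := j) (w := i)
    rw [Equiv.swap_apply_of_ne_of_ne hip hiq] at h
    simp [PEquiv.toMatrix_apply, Matrix.one_apply, h]

/-- Existence of a unitary `W`, acting on the coordinates in `S` only, such that
`W * diagonal a * Wᴴ` has diagonal `b`. -/
def HasDiagonalOn {n : ℕ} (S : Finset (Fin n)) (a b : Fin n → ℝ) : Prop :=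
  ∃ W ∈ Matrix.unitaryGroup (Fin n) ℂ, W.IsSupportedOn S ∧
    ∀ i, (W * Matrix.diagonal (fun j => (a j : ℂ)) * Wᴴ) i i = (b i : ℂ)

theorem HasDiagonalOn.of_comp_swap {n : ℕ} {S : Finset (Fin n)} {a b : Fin n → ℝ} {p q : Fin n}
    (hp : p ∈ S) (hq : q ∈ S) (h : HasDiagonalOn S (a ∘ Equiv.swap p q) b) :
    HasDiagonalOn S a b := by
  obtain ⟨W, hW, hWS, hWb⟩ := h
  refine ⟨W * (Equiv.swap p q).permMatrix ℂ, mul_mem hW (permMatrix_mem_unitaryGroup _),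
    hWS.mul (isSupportedOn_permMatrix_swap hp hq), fun i => ?_⟩
  have h1 := permMatrix_conj_diagonal (Equiv.swap p q) fun i => (a i : ℂ)
  rw [Matrix.transpose_permMatrix, Equiv.swap_inv, Equiv.symm_swap] at h1
  rw [← hWb i, Matrix.conjTranspose_mul, Matrix.conjTranspose_permMatrix, Equiv.swap_inv]
  simp only [mul_assoc] at h1 ⊢
  rw [← mul_assoc (Matrix.diagonal _), ← mul_assoc (Equiv.Perm.permMatrix _ _), h1]
  rfl

theorem exists_sq_add_sq_eq_one_and_eq {x y β : ℝ} (hx : β ≤ x) (hy : y ≤ β) :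
    ∃ c s : ℝ, c ^ 2 + s ^ 2 = 1 ∧ c ^ 2 * x + s ^ 2 * y = β := by
  obtain ⟨u, v, hu, hv, huv, h⟩ : β ∈ segment ℝ x y := by
    rw [segment_symm, segment_eq_Icc (hy.trans hx)]
    exact ⟨hy, hx⟩
  refine ⟨√u, √v, ?_, ?_⟩
  · rw [Real.sq_sqrt hu, Real.sq_sqrt hv, huv]
  · rw [Real.sq_sqrt hu, Real.sq_sqrt hv, ← h, smul_eq_mul, smul_eq_mul]

theorem HasDiagonalOn.of_rotation {n : ℕ} {R : Finset (Fin n)} {a b : Fin n → ℝ} {p q : Fin n}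
    (hp : p ∉ R) (hq : q ∈ R) (hpa : b p ≤ a p) (hqa : a q ≤ b p)
    (h : HasDiagonalOn R (Function.update (Function.update a p (b p)) q (a p + a q - b p)) b) :
    HasDiagonalOn (insert p R) a b := by
  have hpq : p ≠ q := fun h => hp (h ▸ hq)
  obtain ⟨W, hW, hWR, hWb⟩ := h
  obtain ⟨c, s, hcs, hβ⟩ := exists_sq_add_sq_eq_one_and_eq hpa hqa
  obtain ⟨e, he⟩ := planeRotation_conj_diagonal hpq hcs hβ
  refine ⟨W * planeRotation p q c s, mul_mem hW (planeRotation_mem_unitaryGroup hpq hcs),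
    (hWR.mono (Finset.subset_insert p R)).mul (isSupportedOn_planeRotation
      (Finset.mem_insert_self p R) (Finset.mem_insert_of_mem hq) c s), fun i => ?_⟩
  have hmul : W * planeRotation p q c s * Matrix.diagonal (fun j => (a j : ℂ)) *
      (W * planeRotation p q c s)ᴴ = W * (planeRotation p q c s *
        Matrix.diagonal (fun j => (a j : ℂ)) * (planeRotation p q c s)ᴴ) * Wᴴ := by
    simp only [Matrix.conjTranspose_mul, mul_assoc]
  -- Since `W` fixes the coordinate `p`, no row meets both `p` and `q`; hence the off-diagonal
  -- entries `e` never reach the final diagonal.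
  have hzero : W i p = 0 ∨ W i q = 0 := by
    rcases eq_or_ne i p with rfl | hi
    · exact Or.inr (by rw [(hWR i hp q).1, Matrix.one_apply_ne hpq])
    · exact Or.inl (by rw [(hWR p hp i).2, Matrix.one_apply_ne hi])
  rw [hmul, he, mul_add, mul_add, add_mul, add_mul, Matrix.add_apply, Matrix.add_apply, hWb i,
    mul_single_mul_apply, mul_single_mul_apply, Matrix.conjTranspose_apply,
    Matrix.conjTranspose_apply]
  rcases hzero with h0 | h0 <;> simp [h0]

/-- Induction on the size of `S`, settling at each step the coordinate `p` where `b` is largest. The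
domination is kept in truncated form, so no set has to be re-sorted. -/
theorem hasDiagonalOn_of_sum_max_le {n : ℕ} (S : Finset (Fin n)) (a b : Fin n → ℝ)
    (hoff : ∀ i ∉ S, a i = b i) (hsum : ∑ i ∈ S, a i = ∑ i ∈ S, b i)
    (hdom : ∀ t : ℝ, ∑ i ∈ S, max (b i - t) 0 ≤ ∑ i ∈ S, max (a i - t) 0) :
    HasDiagonalOn S a b := by
  induction hk : S.card generalizing S a with
  | zero =>
    rw [Finset.card_eq_zero] at hk
    subst hk
    exact ⟨1, one_mem _, fun i _ j => ⟨rfl, rfl⟩, fun i => by simp [hoff i (by simp)]⟩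
  | succ k ih =>
    have hS : S.Nonempty := Finset.card_pos.mp (by omega)
    obtain ⟨p, hpS, hmax⟩ := S.exists_max_image b hS
    obtain ⟨p₀, hp₀S, hp₀⟩ : ∃ i ∈ S, b p ≤ a i := by
      obtain ⟨j, hjS, hj⟩ := S.exists_max_image a hS
      refine ⟨j, hjS, ?_⟩
      by_contra! hlt
      -- At the level of the largest `a j` the right side vanishes, so no `b i` can exceed it.
      have h1 := hdom (a j)
      rw [Finset.sum_eq_zero fun i hi => max_eq_right (sub_nonpos.mpr (hj i hi))] at h1
      have h2 : max (b p - a j) 0 ≤ ∑ i ∈ S, max (b i - a j) 0 :=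
        Finset.single_le_sum (f := fun i => max (b i - a j) 0) (fun i _ => le_max_right _ _) hpS
      linarith [le_max_left (b p - a j) 0]
    refine HasDiagonalOn.of_comp_swap hp₀S hpS ?_
    set a' := a ∘ Equiv.swap p₀ p with ha'
    have hswap : ∀ i, Equiv.swap p₀ p i ∈ S ↔ i ∈ S := fun i => by
      by_cases h1 : i = p₀
      · simp [h1, hp₀S, hpS]
      by_cases h2 : i = p
      · simp [h2, hp₀S, hpS]
      rw [Equiv.swap_apply_of_ne_of_ne h1 h2]
    have hcomp : ∀ f : ℝ → ℝ, ∑ i ∈ S, f (a' i) = ∑ i ∈ S, f (a i) := fun f =>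
      Finset.sum_equiv (Equiv.swap p₀ p) (fun i => (hswap i).symm) fun i _ => rfl
    have hsum' : ∑ i ∈ S, a' i = ∑ i ∈ S, b i := (hcomp id).trans hsum
    have hdom' : ∀ t : ℝ, ∑ i ∈ S, max (b i - t) 0 ≤ ∑ i ∈ S, max (a' i - t) 0 := fun t =>
      (hdom t).trans_eq (hcomp fun y => max (y - t) 0).symm
    have hoff' : ∀ i ∉ S, a' i = b i := fun i hi => by
      rw [← hoff i hi, ha', Function.comp_apply, Equiv.swap_apply_of_ne_of_ne]
      · exact fun h => hi (h ▸ hp₀S)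
      · exact fun h => hi (h ▸ hpS)
    have hpa : b p ≤ a' p := by simpa [ha'] using hp₀
    clear_value a'
    obtain ⟨R, hpR, rfl⟩ : ∃ R, p ∉ R ∧ insert p R = S :=
      ⟨S.erase p, Finset.notMem_erase p S, Finset.insert_erase hpS⟩
    rw [Finset.card_insert_of_notMem hpR] at hk
    rcases R.eq_empty_or_nonempty with rfl | hR
    · refine ⟨1, one_mem _, fun i _ j => ⟨rfl, rfl⟩, fun i => ?_⟩
      have : a' i = b i := by
        by_cases hi : i = p
        · simpa [hi] using hsum'
        · exact hoff' i (by simpa using hi)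
      simp [this]
    -- If all other entries exceeded `b p`, they would exceed the corresponding `b i`, contradicting
    -- the equality of sums.
    obtain ⟨q', hq'R, hq'⟩ : ∃ i ∈ R, a' i ≤ b p := by
      by_contra! hlt
      have h1 : ∑ i ∈ R, b i < ∑ i ∈ R, a' i := Finset.sum_lt_sum_of_nonempty hR fun i hi =>
        (hmax i (Finset.mem_insert_of_mem hi)).trans_lt (hlt i hi)
      rw [Finset.sum_insert hpR, Finset.sum_insert hpR] at hsum'
      linarith
    -- Taking the largest entry not above `b p` supplies the gap hypothesis of `sum_max_erase_le`.
    obtain ⟨q, hq, hqmax⟩ := (R.filter fun i => a' i ≤ b p).exists_max_image a'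
      ⟨q', Finset.mem_filter.mpr ⟨hq'R, hq'⟩⟩
    obtain ⟨hqR, hqa⟩ := Finset.mem_filter.mp hq
    refine HasDiagonalOn.of_rotation hpR hqR hpa hqa (ih R _ (fun i hi => ?_) ?_ (fun t => ?_)
      (by omega))
    · have hiq : i ≠ q := fun h => hi (h ▸ hqR)
      rw [Function.update_of_ne hiq]
      by_cases hip : i = p
      · rw [hip, Function.update_self]
      · rw [Function.update_of_ne hip]
        exact hoff' i (by simp [hip, hi])
    all_goals
      have hrest : ∀ i ∈ R.erase q, Function.update (Function.update a' p (b p)) q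
          (a' p + a' q - b p) i = a' i := fun i hi => by
        rw [Function.update_of_ne (Finset.ne_of_mem_erase hi), Function.update_of_ne]
        exact fun h => hpR (h ▸ Finset.mem_of_mem_erase hi)
    · rw [← Finset.add_sum_erase R _ hqR, Function.update_self, Finset.sum_congr rfl hrest]
      rw [Finset.sum_insert hpR, Finset.sum_insert hpR, ← Finset.add_sum_erase R a' hqR] at hsum'
      linarith
    · rw [← Finset.add_sum_erase R (fun i => max (Function.update (Function.update a' p (b p)) q
        (a' p + a' q - b p) i - t) 0) hqR, Function.update_self,
        Finset.sum_congr rfl fun i hi => congrArg (fun y => max (y - t) 0) (hrest i hi), add_comm]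
      exact sum_max_erase_le hpR hqR hdom'
        (fun i hi => hmax i (Finset.mem_insert_of_mem hi)) hpa hqa
        (fun i hi _ => (le_total (b p) (a' i)).imp_right fun h =>
          hqmax i (Finset.mem_filter.mpr ⟨hi, h⟩)) t

theorem IsMajorizedBy.exists_unitary_diag_eq {n : ℕ} {a b : Fin n → ℝ} (h : IsMajorizedBy b a) :
    ∃ W ∈ Matrix.unitaryGroup (Fin n) ℂ,
      ∀ i, (W * Matrix.diagonal (fun j => (a j : ℂ)) * Wᴴ) i i = (b i : ℂ) := by
  obtain ⟨hdom, hsum⟩ := (isMajorizedBy_iff_sum_max b a).mp h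
  obtain ⟨W, hW, -, hWb⟩ := hasDiagonalOn_of_sum_max_le Finset.univ a b (by simp) hsum hdom
  exact ⟨W, hW, hWb⟩

theorem theorem3p6 (n : ℕ) (A B : Matrix (Fin n) (Fin n) ℂ)
    (hA : A.IsHermitian) (hB : B.IsHermitian) (a b : Fin n → ℝ)
    (ha : IsEigenvalueVector A a) (hb : IsEigenvalueVector B b) :
    List.TFAE [
      -- (a)
      ∃ Φ : MatrixCPMap n n, Φ.IsUnital ∧ Φ.IsTracePreserving ∧ Φ A = B,
      -- (a1)
      ∃ Φ : MatrixCPMap n n, Φ.IsMixedUnitary ∧ Φ A = B,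
      -- (a2)
      ∃ U : Fin n → Matrix (Fin n) (Fin n) ℂ,
        (∀ j, U j ∈ Matrix.unitaryGroup (Fin n) ℂ) ∧
          B = (1 / (n : ℂ)) • ∑ j, (U j)ᴴ * A * U j,
      -- (a3)
      ∀ t : ℝ, ∃ Φ : MatrixCPMap n n, Φ.IsTracePreserving ∧
        Φ (A - (t : ℂ) • (1 : Matrix (Fin n) (Fin n) ℂ)) =
          B - (t : ℂ) • (1 : Matrix (Fin n) (Fin n) ℂ),
      -- (b)
      ∃ D ∈ doublyStochastic ℝ (Fin n), b = a ᵥ* D,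
      -- (b1)
      ∃ W ∈ Matrix.unitaryGroup (Fin n) ℂ,
        ∀ i, (W * Matrix.diagonal (fun j => (a j : ℂ)) * Wᴴ) i i = (b i : ℂ),
      -- (c)
      IsMajorizedBy b a] ∧
    (∃ U ∈ Matrix.unitaryGroup (Fin n) ℂ, Uᴴ * A * U = Matrix.diagonal (fun i => (a i : ℂ))) ∧
    (∃ V ∈ Matrix.unitaryGroup (Fin n) ℂ, V * B * Vᴴ = Matrix.diagonal (fun i => (b i : ℂ))) ∧
    (∀ D ∈ doublyStochastic ℝ (Fin n), b = a ᵥ* D →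
      ∀ (r : ℕ) (t : Fin r → ℝ) (σ : Fin r → Equiv.Perm (Fin n)),
        (∀ l, 0 < t l) → ∑ l, t l = 1 → D = ∑ l, t l • (σ l).permMatrix ℝ →
      ∀ U ∈ Matrix.unitaryGroup (Fin n) ℂ, ∀ V ∈ Matrix.unitaryGroup (Fin n) ℂ,
        Uᴴ * A * U = Matrix.diagonal (fun i => (a i : ℂ)) →
        V * B * Vᴴ = Matrix.diagonal (fun i => (b i : ℂ)) →
        B = ∑ l, (t l : ℂ) •
          (Vᴴ * ((σ l).permMatrix ℂ)ᵀ * Uᴴ * A * U * (σ l).permMatrix ℂ * V)) := by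
  refine ⟨?_, hA.exists_unitary_conj_eq_diagonal ha, ?_, ?_⟩
  -- The implications form the cycle 3 → 2 → 1 → 4 → 7 → 6 → 3, with the detour 6 → 5 → 2 through
  -- doubly stochastic matrices.
  · tfae_have 3 → 2 := fun ⟨U, hU, h⟩ => exists_isMixedUnitary_of_average hU h
    tfae_have 2 → 1 := fun ⟨Φ, hΦ, h⟩ => ⟨Φ, hΦ.isUnital, hΦ.isTracePreserving, h⟩
    -- By unitality the same map serves every `t`.
    tfae_have 1 → 4 := fun ⟨Φ, hΦ1, hΦ, h⟩ t => ⟨Φ, hΦ, by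
      rw [MatrixCPMap.map_sub', MatrixCPMap.map_smul', h, hΦ1]⟩
    tfae_have 4 → 7 := isMajorizedBy_of_isTracePreserving hA hB ha hb
    tfae_have 7 → 6 := IsMajorizedBy.exists_unitary_diag_eq
    tfae_have 6 → 3 := fun ⟨W, hW, h⟩ => exists_average_of_diag_eq hA hB ha hb hW h
    tfae_have 6 → 5 := fun ⟨W, hW, h⟩ => exists_doublyStochastic_of_diag_eq hW h
    tfae_have 5 → 2 := fun ⟨D, hD, h⟩ =>
      exists_isMixedUnitary_of_doublyStochastic hA hB ha hb hD h
    tfae_finish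
  · obtain ⟨V, hV, hVB⟩ := hB.exists_unitary_conj_eq_diagonal hb
    exact ⟨Vᴴ, conjTranspose_mem_unitaryGroup hV, by rwa [Matrix.conjTranspose_conjTranspose]⟩
  · intro D _ h r t σ _ _ hD U _ V hV hUA hVB
    subst hD
    exact eq_sum_permMatrix_conj h hV hUA hVB
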